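/- **Theorem (Unbounded Godefroy's Theorem).** Let $E$ be a real Banach space with dual $E^{*}$ and bidual $E^{**}$. For a nonempty set $D\subset E^{*}$ put $$L_D:=\Big\{x\in E:\ \sup_{d^*\in D}\langle x,d^*\rangle<0\Big\},\qquad \Lambda_D:=\{0\}\cup\{\lambda d^{*}:\ \lambda>0,\ d^{*}\in D\}.$$ Let $D\subset E^{*}$ be a nonempty convex weak$^*$-compact set with $0\notin D$, and let $B\subset E^{*}$ be a nonempty set satisfying (i) for each $x\in L_D$ there is $b^{*}\in B$ with $\langle x,b^{*}\rangle=\sup_{c^*\in B}\langle x,c^{*}\rangle$; (ii) for every convex bounded subset $L\subset E$ and every $x^{**}$ in the weak$^*$-closure $\overline{L}^{\,w^{*}}\subset E^{**}$ of (the canonical image of) $L$ there is a sequence $(y_n)_{n\in\mathbb N}$ in $L$ such that $\langle x^{**},z^{*}\rangle=\lim_n\langle y_n,z^{*}\rangle$ for every $z^{*}\in B\cup D$. Then $$\overline{\operatorname{co}(B)}^{\,w^{*}}\subset\overline{\operatorname{co}(B)+\Lambda_D}^{\,\|\cdot\|}.$$ Moreover, if $D$ is weakly compact (that is, compact for $\sigma(E^{*},E^{**})$),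 then $$\overline{\operatorname{co}(B)}^{\,w^{*}}\subset\overline{\operatorname{co}(B)}^{\,\|\cdot\|}+\Lambda_D.$$ Here $\operatorname{co}$ denotes the convex hull. -/

import Mathlib

open Set Filter Topology
open scoped Pointwise

noncomputable section

/-- The supremum `sup (x, S)` of a vector `x`, seen as the function `f ↦ ⟨x, f⟩` on the dual,
over a set `S` of functionals, as an extended real number. -/
def dualSup {E : Type*} [NormedAddCommGroup E] [NormedSpace ℝ E]
    (x : E) (S : Set (StrongDual ℝ E)) : EReal :=
  ⨆ f ∈ S, ((f x : ℝ) : EReal)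

/-- The set of directions `L_D ⊆ E` of a set `D` of functionals: the vectors `x` with
`sup (x, D) < 0` if `D` is nonempty, and `E \ {0}` if `D` is empty. -/
def directionSet {E : Type*} [NormedAddCommGroup E] [NormedSpace ℝ E]
    (D : Set (StrongDual ℝ E)) : Set E :=
  {x | (D = ∅ ∧ x ≠ 0) ∨ (D.Nonempty ∧ dualSup x D < 0)}

/-- The cone `Λ_D` generated by a subset `D` of a real vector space. -/
def generatedCone {F : Type*} [AddCommGroup F] [Module ℝ F] (D : Set F) : Set F :=
  {0} ∪ {g | ∃ c : ℝ, 0 < c ∧ ∃ f ∈ D, g = c • f}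

/-- The weak* closure of a set of functionals. -/
def weakStarClosure {E : Type*} [NormedAddCommGroup E] [NormedSpace ℝ E]
    (S : Set (StrongDual ℝ E)) : Set (StrongDual ℝ E) :=
  {f | StrongDual.toWeakDual f ∈ closure (StrongDual.toWeakDual '' S)}

/-- Compactness in the weak* topology of the dual. -/
def IsWeakStarCompact {E : Type*} [NormedAddCommGroup E] [NormedSpace ℝ E]
    (S : Set (StrongDual ℝ E)) : Prop :=
  IsCompact (StrongDual.toWeakDual '' S)

/-- Compactness in the weak topology of a normed space. -/
def IsWeaklyCompact {F : Type*} [NormedAddCommGroup F] [NormedSpace ℝ F] (S : Set F) : Prop :=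
  IsCompact (toWeakSpace ℝ F '' S)

end

/-! If `f` in the weak* closure of `co B` lay outside the norm closure of `co B + Λ_D`, Hahn–Banach
would give `φ` in the bidual separating them, and `φ ≤ 0` on `D` because `Λ_D` is a cone. Adding a
small multiple of some `x₀ ∈ L_D` makes `φ` uniformly negative on `D` and keeps the separation,
since `x₀` attains its maximum on `B`. A constrained Goldstine theorem and hypothesis (ii) then
yield bounded `y n ∈ L_D` with `f (y n) ≥ β`, converging on `B` to `φ < α < β`. Closed convex hulls
of tails stay in `L_D`, where suprema over `B` are attained and at least `β`; `simons_inequality`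
then contradicts the convergence at a single `b ∈ B`. For weakly compact `D`, `x₀` bounds the
multipliers in `Λ_D`, and closed plus compact is closed. -/

theorem WeakDual.exists_eq_eval {E : Type*} [NormedAddCommGroup E] [NormedSpace ℝ E]
    (f : StrongDual ℝ (WeakDual ℝ E)) : ∃ x : E, ∀ g : WeakDual ℝ E, f g = g x := by
  obtain ⟨x, hx⟩ := LinearMap.dualEmbedding_surjective (topDualPairing ℝ E) f
  exact ⟨x, fun g => (congrArg (fun k => k g) hx).symm⟩

instance WeakDual.locallyConvexSpace {E : Type*} [NormedAddCommGroup E] [NormedSpace ℝ E] :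
    LocallyConvexSpace ℝ (WeakDual ℝ E) :=
  (WeakDual.withSeminorms ℝ E).toLocallyConvexSpace

theorem Convex.image_toWeakDual {E : Type*} [NormedAddCommGroup E] [NormedSpace ℝ E]
    {D : Set (StrongDual ℝ E)} (hD : Convex ℝ D) : Convex ℝ (StrongDual.toWeakDual '' D) :=
  hD.is_linear_image ⟨map_add _, map_smul _⟩

theorem IsCompact.convexJoin {F : Type*} [AddCommGroup F] [Module ℝ F] [TopologicalSpace F]
    [ContinuousAdd F] [ContinuousSMul ℝ F] {s t : Set F} (hs : IsCompact s) (ht : IsCompact t) :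
    IsCompact (convexJoin ℝ s t) := by
  have h := ((isCompact_Icc (a := (0 : ℝ)) (b := 1)).prod (hs.prod ht)).image
    (f := fun p : ℝ × F × F => (1 - p.1) • p.2.1 + p.1 • p.2.2) (by fun_prop)
  convert h using 1
  ext z
  simp only [mem_convexJoin, segment_eq_image, mem_image, Prod.exists, mem_prod]
  constructor
  · rintro ⟨a, ha, b, hb, c, hc, rfl⟩
    exact ⟨c, a, b, ⟨hc, ha, hb⟩, rfl⟩
  · rintro ⟨c, a, b, ⟨hc, ha, hb⟩, rfl⟩
    exact ⟨a, ha, b, hb, c, hc, rfl⟩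

/-! ### Helly's theorem in the bidual -/

/-- A Helly-type theorem: a system of inequalities `f x < c`, indexed by a weak* compact convex set
of pairs `(f, c)` and solved by an element of the bidual, is solved by an element of the space of
no larger norm. -/
theorem exists_norm_le_forall_lt_of_bidual {E : Type*} [NormedAddCommGroup E] [NormedSpace ℝ E]
    {K : Set (WeakDual ℝ E × ℝ)} (hK : IsCompact K) (hKc : Convex ℝ K) (hKne : K.Nonempty)
    (φ : StrongDual ℝ (StrongDual ℝ E))
    (hφ : ∀ p ∈ K, φ (WeakDual.toStrongDual p.1) < p.2) :
    ∃ x : E, ‖x‖ ≤ ‖φ‖ ∧ ∀ p ∈ K, p.1 x < p.2 := by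
  -- `P` is the closed convex cone `c ≤ -‖φ‖ * ‖f‖`. Separating it from `K` gives an evaluation at
  -- `x` plus a multiple `t` of `c`; rescaling by `-t` gives the solution.
  let P : Set (WeakDual ℝ E × ℝ) := {p | ∀ x : E, ‖x‖ ≤ ‖φ‖ → p.2 ≤ p.1 x}
  have hP : P = ⋂ x : E, ⋂ _ : ‖x‖ ≤ ‖φ‖, {p | p.2 ≤ p.1 x} := by
    ext p; simp [P]
  have hPcl : IsClosed P := by
    rw [hP]
    exact isClosed_iInter fun x => isClosed_iInter fun _ =>
      isClosed_le continuous_snd ((WeakDual.eval_continuous x).comp continuous_fst)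
  have hPc : Convex ℝ P := by
    intro p hp q hq a b ha hb _ x hx
    have h1 := mul_le_mul_of_nonneg_left (hp x hx) ha
    have h2 := mul_le_mul_of_nonneg_left (hq x hx) hb
    change a * p.2 + b * q.2 ≤ a * p.1 x + b * q.1 x
    linarith
  have hP_of_norm : ∀ p : WeakDual ℝ E × ℝ,
      p.2 ≤ -(‖φ‖ * ‖WeakDual.toStrongDual p.1‖) → p ∈ P := by
    intro p hp x hx
    have h1 := (WeakDual.toStrongDual p.1).le_opNorm x
    have h2 := mul_le_mul_of_nonneg_left hx (norm_nonneg (WeakDual.toStrongDual p.1))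
    have h3 := neg_abs_le (p.1 x)
    rw [Real.norm_eq_abs] at h1
    change |p.1 x| ≤ _ at h1
    linarith
  have hP_norm : ∀ p ∈ P, p.2 ≤ φ (WeakDual.toStrongDual p.1) := by
    intro p hp
    set f := WeakDual.toStrongDual p.1 with hf
    have key : ∀ x : E, ‖x‖ ≤ ‖φ‖ → |f x| ≤ -p.2 := by
      intro x hx
      have h1 := hp x hx
      have h2 := hp (-x) (by simpa using hx)
      change p.2 ≤ f x at h1
      change p.2 ≤ f (-x) at h2
      rw [map_neg] at h2
      exact abs_le.2 ⟨by linarith, by linarith⟩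
    have h0 : (0 : ℝ) ≤ -p.2 := (abs_nonneg _).trans (key 0 (by rw [norm_zero]; positivity))
    have h3 : ‖φ‖ * ‖f‖ ≤ -p.2 := by
      rcases (norm_nonneg φ).eq_or_lt with hz | hz
      · rw [← hz]; simpa using h0
      · have : ‖f‖ ≤ -p.2 / ‖φ‖ :=
          ContinuousLinearMap.opNorm_bound_of_ball_bound hz _ f fun y hy =>
            key y (mem_closedBall_zero_iff.1 hy)
        rw [le_div_iff₀ hz] at this
        linarith
    have h4 := φ.le_opNorm f
    have h5 := neg_abs_le (φ f)
    rw [Real.norm_eq_abs] at h4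
    linarith
  have hdisj : Disjoint K P := by
    rw [Set.disjoint_left]
    intro p hpK hpP
    exact absurd (hφ p hpK) (not_lt.2 (hP_norm p hpP))
  obtain ⟨Φ, u, v, hKu, huv, hPv⟩ := geometric_hahn_banach_compact_closed hKc hK hPc hPcl hdisj
  obtain ⟨x, hx⟩ := WeakDual.exists_eq_eval (Φ.comp (ContinuousLinearMap.inl ℝ _ ℝ))
  set t : ℝ := Φ (0, 1) with ht
  have hΦ : ∀ p : WeakDual ℝ E × ℝ, Φ p = p.1 x + p.2 * t := by
    intro p
    have h1 : p = (p.1, 0) + p.2 • ((0, 1) : WeakDual ℝ E × ℝ) := by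
      ext <;> simp
    have h2 := hx p.1
    simp only [ContinuousLinearMap.comp_apply, ContinuousLinearMap.inl_apply] at h2
    conv_lhs => rw [h1]
    rw [map_add, map_smul, h2, smul_eq_mul]
  have hv : v < 0 := by
    have := hPv 0 (hP_of_norm _ (by simp))
    rwa [map_zero] at this
  have hPnn : ∀ p ∈ P, 0 ≤ Φ p := by
    intro p hp
    by_contra! hneg
    obtain ⟨n, hn⟩ := exists_nat_gt (v / Φ p)
    have hmem : (n : ℝ) • p ∈ P := by
      intro y hy
      have := mul_le_mul_of_nonneg_left (hp y hy) (Nat.cast_nonneg (α := ℝ) n)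
      exact this
    have h1 := hPv _ hmem
    rw [map_smul, smul_eq_mul] at h1
    rw [div_lt_iff_of_neg hneg] at hn
    linarith
  have ht0 : t ≤ 0 := by
    have h := hPnn (0, -1) (hP_of_norm _ (by simp))
    rw [hΦ] at h
    change 0 ≤ (0 : ℝ) + -1 * t at h
    linarith
  have hxn : ‖x‖ ≤ ‖φ‖ * (-t) := by
    obtain ⟨f, hf1, hfx⟩ := exists_dual_vector'' ℝ x
    have h := hPnn (StrongDual.toWeakDual (-f), -(‖φ‖ * ‖f‖)) (hP_of_norm _ (by
      simp [StrongDual.toStrongDual_toWeakDual]))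
    rw [hΦ] at h
    change 0 ≤ (-f) x + _ at h
    simp only [neg_apply, hfx] at h
    have h2 : ‖φ‖ * ‖f‖ * (-t) ≤ ‖φ‖ * 1 * (-t) := by gcongr; linarith
    simp at h
    linarith
  -- If `t = 0`, then `x = 0` and `Φ = 0`, contradicting `Φ < v < 0` on `K`.
  have htneg : t < 0 := by
    rcases ht0.lt_or_eq with h | h
    · exact h
    · obtain ⟨p, hp⟩ := hKne
      have h1 := hKu p hp
      have hx0 : x = 0 := by
        rw [h] at hxn
        exact norm_le_zero_iff.1 (by simpa using hxn)
      rw [hΦ, h, hx0] at h1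
      simp at h1
      linarith
  refine ⟨(-t)⁻¹ • x, ?_, fun p hp => ?_⟩
  · rw [norm_smul, norm_inv, Real.norm_of_nonneg (by linarith : 0 ≤ -t), inv_mul_le_iff₀ (by linarith)]
    linarith
  · have h1 := hKu p hp
    rw [hΦ] at h1
    rw [map_smul, smul_eq_mul, inv_mul_lt_iff₀ (by linarith)]
    linarith

/-! ### Simons' inequality -/

/-- Simons' inequality for a decreasing sequence of bounded closed convex sets. -/
theorem simons_inequality {E : Type*} [NormedAddCommGroup E] [NormedSpace ℝ E] [CompleteSpace E]
    {C : ℕ → Set E} (hCcl : ∀ n, IsClosed (C n)) (hCc : ∀ n, Convex ℝ (C n)) (hCa : Antitone C)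
    (hCne : ∀ n, (C n).Nonempty) {R : ℝ} (hR : ∀ x ∈ C 0, ‖x‖ ≤ R)
    {B : Set (StrongDual ℝ E)} {β : ℝ}
    (hB : ∀ x ∈ C 0, ∃ b ∈ B, (∀ c ∈ B, c x ≤ b x) ∧ β ≤ b x) {ε : ℝ} (hε : 0 < ε) :
    ∃ b ∈ B, ∀ n, ∃ h ∈ C n, β - ε ≤ b h := by
  -- `S` is the supremum over `B` on `C 0`; the default `β` elsewhere keeps it bounded below.
  obtain ⟨S, hSβ, hS⟩ : ∃ S : E → ℝ, (∀ x, β ≤ S x) ∧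
      ∀ x ∈ C 0, (∀ c ∈ B, c x ≤ S x) ∧ ∃ b ∈ B, b x = S x := by
    classical
    choose! b hb hb1 hb2 using hB
    refine ⟨fun x => if x ∈ C 0 then b x x else β, fun x => ?_, fun x hx => ?_⟩
    · dsimp only
      split_ifs with h
      · exact hb2 x h
      · exact le_rfl
    · simp only [hx, if_true]
      exact ⟨hb1 x hx, b x, hb x hx, rfl⟩
  have hG : ∀ (n : ℕ) (u : E), ∃ g ∈ C n, ∀ h ∈ C n,
      S (u + (1 / 2 : ℝ) ^ n • g) ≤ S (u + (1 / 2 : ℝ) ^ n • h) + ε * (1 / 4) ^ (n + 1) := by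
    intro n u
    let V : Set ℝ := (fun h => S (u + (1 / 2 : ℝ) ^ n • h)) '' C n
    have hVb : BddBelow V := ⟨β, by rintro _ ⟨h, -, rfl⟩; exact hSβ _⟩
    obtain ⟨_, ⟨g, hg, rfl⟩, hlt⟩ := exists_lt_of_csInf_lt ((hCne n).image _)
      (lt_add_of_pos_right (sInf V) (by positivity : 0 < ε * (1 / 4 : ℝ) ^ (n + 1)))
    refine ⟨g, hg, fun h hh => hlt.le.trans ?_⟩
    gcongr
    exact csInf_le hVb ⟨h, hh, rfl⟩
  choose G hGC hGS using hG
  -- `G n` is nearly optimal for weight `2⁻ⁿ`, but only half that weight is spent: `2⁻ⁿ` is the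
  -- total weight of the remaining tail, so the tail average competes with `G n`.
  let u : ℕ → E := fun n => Nat.rec 0 (fun k w => w + (1 / 2 : ℝ) ^ (k + 1) • G k w) n
  have hu0 : u 0 = 0 := rfl
  have hus : ∀ n, u (n + 1) = u n + (1 / 2 : ℝ) ^ (n + 1) • G n (u n) := fun n => rfl
  -- The first term has weight `1 - 2⁻ᵐ`; `g` supplies the rest of a convex combination.
  have hinv : ∀ n m, ∀ g ∈ C n,
      (2 : ℝ) ^ n • (u (n + m) - u n) + (1 / 2 : ℝ) ^ m • g ∈ C n := by
    intro n m
    induction m with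
    | zero => intro g hg; simpa using hg
    | succ m ih =>
      intro g hg
      have hmid := (hCc n) (hCa (Nat.le_add_right n m) (hGC (n + m) (u (n + m)))) hg
        (by norm_num : (0 : ℝ) ≤ 1 / 2) (by norm_num : (0 : ℝ) ≤ 1 / 2) (by norm_num)
      convert ih _ hmid using 1
      rw [← add_assoc, hus]
      have h2 : (2 : ℝ) ^ n * (1 / 2) ^ (n + m + 1) = (1 / 2) ^ m * (1 / 2) := by
        rw [show n + m + 1 = n + (m + 1) by ring, pow_add (1 / 2 : ℝ) n, ← mul_assoc, ← mul_pow]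
        norm_num [pow_succ]
      rw [add_sub_right_comm, smul_add, smul_smul, h2, smul_add, smul_smul, smul_smul, pow_succ]
      abel
  have hcauchy : CauchySeq u := by
    refine cauchySeq_of_le_geometric_two (C := R) fun n => ?_
    rw [hus, dist_eq_norm, sub_add_cancel_left, norm_neg, norm_smul, norm_pow]
    have := hR _ (hCa (Nat.zero_le n) (hGC n (u n)))
    calc ‖(1 / 2 : ℝ)‖ ^ (n + 1) * ‖G n (u n)‖ ≤ ‖(1 / 2 : ℝ)‖ ^ (n + 1) * R := by gcongr
      _ = R / 2 / 2 ^ n := by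
        rw [Real.norm_of_nonneg (by norm_num), pow_succ, one_div, inv_pow]; field_simp
  obtain ⟨g, hg⟩ := cauchySeq_tendsto_of_complete hcauchy
  have htail : ∀ n, (2 : ℝ) ^ n • (g - u n) ∈ C n := by
    intro n
    obtain ⟨c, hc⟩ := hCne n
    have h1 : Tendsto (fun m => (2 : ℝ) ^ n • (u (n + m) - u n) + (1 / 2 : ℝ) ^ m • c) atTop
        (𝓝 ((2 : ℝ) ^ n • (g - u n) + (0 : ℝ) • c)) := by
      have hg' : Tendsto (fun m => u (n + m)) atTop (𝓝 g) := by
        simpa only [add_comm] using (tendsto_add_atTop_iff_nat n).2 hg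
      exact ((hg'.sub_const _).const_smul _).add
        ((tendsto_pow_atTop_nhds_zero_of_lt_one (by norm_num) (by norm_num)).smul_const c)
    rw [zero_smul, add_zero] at h1
    exact (hCcl n).mem_of_tendsto h1 (Eventually.of_forall fun m => hinv n m c hc)
  have hg0 : g ∈ C 0 := by simpa [hu0] using htail 0
  obtain ⟨b, hbB, hbg⟩ := (hS g hg0).2
  have hpow : ∀ n : ℕ, (1 / 2 : ℝ) ^ n * 2 ^ n = 1 := fun n => by rw [← mul_pow]; norm_num
  have hstep : ∀ n, b (u n) + (1 / 2 : ℝ) ^ n * b (G n (u n)) ≤ S g + ε * (1 / 4) ^ (n + 1) := by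
    intro n
    have hmem : u n + (1 / 2 : ℝ) ^ n • G n (u n) ∈ C 0 := by
      have := hinv 0 n _ (hCa (Nat.zero_le n) (hGC n (u n)))
      simpa [hu0] using this
    have h1 := (hS _ hmem).1 b hbB
    have h2 := hGS n (u n) _ (htail n)
    rw [smul_smul, hpow, one_smul, add_sub_cancel] at h2
    rw [map_add, map_smul, smul_eq_mul] at h1
    exact h1.trans h2
  -- Each step loses `ε * 2⁻ⁿ / 4`, within the budget `ε * 2⁻⁽ⁿ⁺¹⁾`. The right side is `b` at the
  -- tail average, as `b g = S g`.
  have hlow : ∀ n : ℕ, β - ε * (1 - (1 / 2) ^ n) ≤ 2 ^ n * (S g - b (u n)) := by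
    intro n
    induction n with
    | zero => simpa [hu0] using hSβ g
    | succ n ih =>
      have h1 := hstep n
      have h2 : b (u (n + 1)) = b (u n) + (1 / 2 : ℝ) ^ (n + 1) * b (G n (u n)) := by
        rw [hus, map_add, map_smul, smul_eq_mul]
      have h3 : S g - b (u n) - ε * (1 / 4) ^ (n + 1) ≤ 2 * (S g - b (u (n + 1))) := by
        rw [h2, pow_succ (1 / 2 : ℝ)]; linarith
      have h4 := mul_le_mul_of_nonneg_left h3 (by positivity : (0 : ℝ) ≤ 2 ^ n)
      have h5 : (2 : ℝ) ^ n * (1 / 4) ^ (n + 1) = (1 / 2) ^ n * (1 / 4) := by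
        rw [pow_succ, ← mul_assoc, ← mul_pow]; norm_num
      have h6 : (2 : ℝ) ^ n * (ε * (1 / 4) ^ (n + 1)) = ε * ((1 / 2) ^ n * (1 / 4)) := by
        rw [← h5]; ring
      have h7 : 0 ≤ ε * (1 / 2) ^ n := by positivity
      rw [pow_succ, pow_succ]
      rw [mul_sub, h6] at h4
      linarith
  refine ⟨b, hbB, fun n => ⟨_, htail n, ?_⟩⟩
  rw [map_smul, map_sub, smul_eq_mul, hbg]
  have : 0 ≤ ε * (1 / 2) ^ n := by positivity
  linarith [hlow n]

/-! ### Separation and Goldstine's theorem -/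

theorem IsWeakStarCompact.exists_forall_le_neg {E : Type*} [NormedAddCommGroup E]
    [NormedSpace ℝ E] {D : Set (StrongDual ℝ E)} (hD : IsWeakStarCompact D) (hDc : Convex ℝ D)
    (h0 : (0 : StrongDual ℝ E) ∉ D) : ∃ x : E, ∃ δ > 0, ∀ d ∈ D, d x ≤ -δ := by
  have hDc' : Convex ℝ (StrongDual.toWeakDual '' D) :=
    hDc.image_toWeakDual
  have hz : (0 : WeakDual ℝ E) ∉ StrongDual.toWeakDual '' D := by
    rintro ⟨d, hd, hd0⟩
    rw [LinearEquiv.map_eq_zero_iff] at hd0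
    exact h0 (hd0 ▸ hd)
  obtain ⟨f, u, hf, hu⟩ := geometric_hahn_banach_closed_point hDc' (IsCompact.isClosed hD) hz
  obtain ⟨x, hx⟩ := WeakDual.exists_eq_eval f
  rw [map_zero] at hu
  refine ⟨x, -u, by linarith, fun d hd => ?_⟩
  have := hf _ ⟨d, hd, rfl⟩
  rw [hx] at this
  rw [neg_neg]
  exact this.le

/-- Goldstine's theorem with additional constraints: an element `φ` of the bidual that lies below
`η` on a weak* compact convex set `D` is a weak* limit of vectors of norm at most `‖φ‖` that lie
below `η` on `D`. -/
theorem mem_weakStarClosure_of_forall_lt {E : Type*} [NormedAddCommGroup E] [NormedSpace ℝ E]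
    {D : Set (StrongDual ℝ E)} (hD : IsWeakStarCompact D) (hDc : Convex ℝ D) (hDne : D.Nonempty)
    (φ : StrongDual ℝ (StrongDual ℝ E)) {η : ℝ} (hφ : ∀ d ∈ D, φ d < η) :
    φ ∈ weakStarClosure
      (NormedSpace.inclusionInDoubleDual ℝ E '' {x | ‖x‖ ≤ ‖φ‖ ∧ ∀ d ∈ D, d x ≤ η}) := by
  set A : Set E := {x | ‖x‖ ≤ ‖φ‖ ∧ ∀ d ∈ D, d x ≤ η} with hA
  have hAc : Convex ℝ A := by
    have h1 : A = Metric.closedBall 0 ‖φ‖ ∩ ⋂ d ∈ D, {x | d x ≤ η} := by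
      ext x; simp [hA]
    rw [h1]
    exact (convex_closedBall _ _).inter
      (convex_iInter₂ fun d _ => convex_halfSpace_le d.toLinearMap.isLinear η)
  by_contra hcon
  have hJc : Convex ℝ (StrongDual.toWeakDual '' (NormedSpace.inclusionInDoubleDual ℝ E '' A)) :=
    (hAc.linear_image (NormedSpace.inclusionInDoubleDual ℝ E).toLinearMap).image_toWeakDual
  obtain ⟨f, s, hf, hs⟩ := geometric_hahn_banach_closed_point hJc.closure isClosed_closure hcon
  obtain ⟨z, hz⟩ := WeakDual.exists_eq_eval f
  have hzφ : s < φ z := hs.trans_eq (hz (StrongDual.toWeakDual φ))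
  have hzA : ∀ x ∈ A, z x < s := by
    intro x hx
    have := hf _ (subset_closure ⟨_, ⟨x, hx, rfl⟩, rfl⟩)
    rw [hz] at this
    exact this
  let D' : Set (WeakDual ℝ E × ℝ) := (StrongDual.toWeakDual '' D) ×ˢ {η}
  have hD'c : Convex ℝ D' :=
    hDc.image_toWeakDual.prod (convex_singleton η)
  have hD'k : IsCompact D' := IsCompact.prod hD isCompact_singleton
  -- The pair `q` encodes `s < z x`, which no point of `A` satisfies; its join with `D'` stays
  -- compact and convex.
  let q : WeakDual ℝ E × ℝ := (StrongDual.toWeakDual (-z), -s)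
  have hq : q ∈ ({q} : Set (WeakDual ℝ E × ℝ)) := rfl
  have hD'ne : D'.Nonempty := (hDne.image _).prod (singleton_nonempty η)
  obtain ⟨x, hxn, hx⟩ := exists_norm_le_forall_lt_of_bidual
    (hD'k.convexJoin (isCompact_singleton (x := q))) (hD'c.convexJoin (convex_singleton q))
    (hD'ne.mono (subset_convexJoin_left (singleton_nonempty q))) φ (by
      intro p hp
      obtain ⟨⟨a, c⟩, ⟨⟨d, hd, rfl⟩, rfl⟩, _, rfl, l, m, hl, hm, hlm, rfl⟩ := mem_convexJoin.1 hp
      have h1 := hφ d hd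
      change φ (l • d + m • (-z)) < l * c + m * (-s)
      rw [map_add, map_smul, map_smul, map_neg, smul_eq_mul, smul_eq_mul]
      rcases hl.eq_or_lt with h | h
      · have hm1 : m = 1 := by linarith
        rw [← h, hm1]; linarith
      · have h2 := mul_lt_mul_of_pos_left h1 h
        have h3 := mul_le_mul_of_nonneg_left hzφ.le hm
        dsimp only at h2
        linarith)
  have hxA : x ∈ A := ⟨hxn, fun d hd =>
    (hx (StrongDual.toWeakDual d, η) (subset_convexJoin_left (singleton_nonempty q)
      ⟨⟨d, hd, rfl⟩, rfl⟩)).le⟩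
  have h1 := hx q (subset_convexJoin_right hD'ne rfl)
  change (-z) x < -s at h1
  rw [neg_apply] at h1
  linarith [hzA x hxA]

theorem le_of_mem_weakStarClosure_convexHull {E : Type*} [NormedAddCommGroup E] [NormedSpace ℝ E]
    {B : Set (StrongDual ℝ E)} {f : StrongDual ℝ E} (hf : f ∈ weakStarClosure (convexHull ℝ B))
    {x : E} {M : ℝ} (hB : ∀ b ∈ B, b x ≤ M) : f x ≤ M := by
  have h1 : ∀ g ∈ convexHull ℝ B, g x ≤ M :=
    convexHull_min (t := {g : StrongDual ℝ E | g x ≤ M}) hB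
      (convex_halfSpace_le (ContinuousLinearMap.apply ℝ ℝ x).toLinearMap.isLinear M)
  have h2 : IsClosed {g : WeakDual ℝ E | g x ≤ M} :=
    isClosed_le (WeakDual.eval_continuous x) continuous_const
  exact closure_minimal (by rintro _ ⟨g, hg, rfl⟩; exact h1 g hg) h2 hf

theorem convex_generatedCone {F : Type*} [AddCommGroup F] [Module ℝ F] {D : Set F}
    (hD : Convex ℝ D) : Convex ℝ (generatedCone D) := by
  rw [convex_iff_forall_pos]
  rintro f hf g hg a b ha hb -
  rcases hf with rfl | ⟨c, hc, d, hd, rfl⟩ <;> rcases hg with rfl | ⟨c', hc', d', hd', rfl⟩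
  · left; simp
  · right; exact ⟨b * c', by positivity, d', hd', by simp [smul_smul]⟩
  · right; exact ⟨a * c, by positivity, d, hd, by simp [smul_smul]⟩
  · right
    have hs : 0 < a * c + b * c' := by positivity
    refine ⟨a * c + b * c', hs, (a * c / (a * c + b * c')) • d + (b * c' / (a * c + b * c')) • d',
      hD hd hd' (by positivity) (by positivity) (by field_simp), ?_⟩
    rw [smul_add, smul_smul, smul_smul, smul_smul, smul_smul, mul_div_cancel₀ _ hs.ne',
      mul_div_cancel₀ _ hs.ne']

theorem mem_directionSet_of_forall_le {E : Type*} [NormedAddCommGroup E] [NormedSpace ℝ E]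
    {D : Set (StrongDual ℝ E)} (hD : D.Nonempty) {x : E} {η : ℝ} (hη : η < 0)
    (hx : ∀ d ∈ D, d x ≤ η) : x ∈ directionSet D := by
  refine Or.inr ⟨hD, lt_of_le_of_lt (iSup₂_le fun d hd => EReal.coe_le_coe_iff.2 (hx d hd)) ?_⟩
  exact_mod_cast hη

/-! ### Contradiction from a separating functional -/

/-- The core of the argument, in terms of an element of the bidual that is negative on `D` and
separates `f` from `B`. -/
theorem bidual_not_separates {E : Type*} [NormedAddCommGroup E] [NormedSpace ℝ E] [CompleteSpace E]
    {D B : Set (StrongDual ℝ E)} (hDne : D.Nonempty) (hDc : Convex ℝ D) (hD : IsWeakStarCompact D)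
    (h_attain : ∀ x ∈ directionSet D, ∃ b ∈ B, ∀ c ∈ B, c x ≤ b x)
    (h_seq : ∀ L : Set E, Convex ℝ L → Bornology.IsBounded L →
      ∀ φ ∈ weakStarClosure (NormedSpace.inclusionInDoubleDual ℝ E '' L),
        ∃ y : ℕ → E, (∀ n, y n ∈ L) ∧ ∀ z ∈ B, Tendsto (fun n => z (y n)) atTop (𝓝 (φ z)))
    {f : StrongDual ℝ E} (hf : f ∈ weakStarClosure (convexHull ℝ B))
    (φ : StrongDual ℝ (StrongDual ℝ E)) {η α β : ℝ} (hη : η < 0) (hφD : ∀ d ∈ D, φ d < η)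
    (hαβ : α < β) (hφB : ∀ b ∈ B, φ b < α) (hφf : β < φ f) : False := by
  set A : Set E := {x | ‖x‖ ≤ ‖φ‖ ∧ ∀ d ∈ D, d x ≤ η} with hA
  let L : Set E := A ∩ {x | β ≤ f x}
  have hLeq : L = (Metric.closedBall 0 ‖φ‖ ∩ ⋂ d ∈ D, {x | d x ≤ η}) ∩ {x | β ≤ f x} := by
    ext x; simp [hA, L]
  have hLc : Convex ℝ L := by
    rw [hLeq]
    exact ((convex_closedBall _ _).inter
      (convex_iInter₂ fun d _ => convex_halfSpace_le d.toLinearMap.isLinear η)).inter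
      (convex_halfSpace_ge f.toLinearMap.isLinear β)
  have hLcl : IsClosed L := by
    rw [hLeq]
    exact (Metric.isClosed_closedBall.inter (isClosed_iInter fun d => isClosed_iInter fun _ =>
      isClosed_le d.continuous continuous_const)).inter (isClosed_le continuous_const f.continuous)
  have hLb : Bornology.IsBounded L :=
    Metric.isBounded_closedBall.subset (fun x hx => mem_closedBall_zero_iff.2 hx.1.1)
  have hφL : φ ∈ weakStarClosure (NormedSpace.inclusionInDoubleDual ℝ E '' L) := by
    have h1 : StrongDual.toWeakDual φ ∈ closure
        (StrongDual.toWeakDual '' (NormedSpace.inclusionInDoubleDual ℝ E '' A)) :=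
      mem_weakStarClosure_of_forall_lt hD hDc hDne φ hφD
    have hopen : IsOpen {ψ : WeakDual ℝ (StrongDual ℝ E) | β < ψ f} :=
      isOpen_lt continuous_const (WeakDual.eval_continuous f)
    have hmem : StrongDual.toWeakDual φ ∈ {ψ : WeakDual ℝ (StrongDual ℝ E) | β < ψ f} := hφf
    have h2 := hopen.inter_closure (mem_inter hmem h1)
    change StrongDual.toWeakDual φ ∈
      closure (StrongDual.toWeakDual '' (NormedSpace.inclusionInDoubleDual ℝ E '' L))
    refine closure_mono ?_ h2
    rintro _ ⟨hψ, _, ⟨x, hx, rfl⟩, rfl⟩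
    have hβx : β < f x := hψ
    exact ⟨_, ⟨x, ⟨hx, hβx.le⟩, rfl⟩, rfl⟩
  obtain ⟨y, hyL, hy⟩ := h_seq L hLc hLb φ hφL
  let C : ℕ → Set E := fun n => closure (convexHull ℝ (y '' Ici n))
  have hCL : ∀ n, C n ⊆ L := fun n => closure_minimal
    (convexHull_min (by rintro _ ⟨k, -, rfl⟩; exact hyL k) hLc) hLcl
  obtain ⟨b, hb, hbC⟩ := simons_inequality (C := C) (B := B) (β := β) (R := ‖φ‖)
    (fun n => isClosed_closure) (fun n => (convex_convexHull ℝ _).closure)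
    (fun m n hmn => closure_mono (convexHull_mono (image_mono (Ici_subset_Ici.2 hmn))))
    (fun n => ⟨y n, subset_closure (subset_convexHull ℝ _ ⟨n, self_mem_Ici, rfl⟩)⟩)
    (fun x hx => (hCL 0 hx).1.1)
    (fun x hx => by
      obtain ⟨b, hb, hmax⟩ :=
        h_attain x (mem_directionSet_of_forall_le hDne hη (hCL 0 hx).1.2)
      exact ⟨b, hb, hmax, (hCL 0 hx).2.trans (le_of_mem_weakStarClosure_convexHull hf hmax)⟩)
    (half_pos (sub_pos.2 hαβ))
  -- From `N` on, `b (y k) < α`, so `b ≤ α` on `C N`; Simons gives a point there with `b ≥ (α + β) /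
  -- 2`.
  obtain ⟨N, hN⟩ := eventually_atTop.1 ((hy b hb).eventually_lt_const (hφB b hb))
  obtain ⟨h, hhC, hh⟩ := hbC N
  have hle : h ∈ {x | b x ≤ α} := closure_minimal
    (convexHull_min (by rintro _ ⟨k, hk, rfl⟩; exact (hN k hk).le)
      (convex_halfSpace_le b.toLinearMap.isLinear α))
    (isClosed_le b.continuous continuous_const) hhC
  have : b h ≤ α := hle
  linarith

theorem forall_le_of_coe_eq_dualSup {E : Type*} [NormedAddCommGroup E] [NormedSpace ℝ E]
    {B : Set (StrongDual ℝ E)} {x : E} {r : ℝ} (h : (r : EReal) = dualSup x B) :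
    ∀ c ∈ B, c x ≤ r := fun c hc => by
  have : ((c x : ℝ) : EReal) ≤ dualSup x B := le_iSup₂ (f := fun (g : StrongDual ℝ E) _ =>
    ((g x : ℝ) : EReal)) c hc
  rw [← h] at this
  exact_mod_cast this

/-! ### Weakly compact `D` -/

/-- If `D` is weakly compact and `ψ` is bounded above on `S` and strictly negative on `D`, then the
closure of `S + Λ_D` is absorbed by `closure S + Λ_D`. -/
theorem closure_add_generatedCone_subset {F : Type*} [NormedAddCommGroup F] [NormedSpace ℝ F]
    {S D : Set F} (hS : Convex ℝ S) (hD : IsWeaklyCompact D) (ψ : StrongDual ℝ F) {M δ : ℝ}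
    (hδ : 0 < δ) (hψS : ∀ s ∈ S, ψ s ≤ M) (hψD : ∀ d ∈ D, ψ d ≤ -δ) :
    closure (S + generatedCone D) ⊆ closure S + generatedCone D := by
  intro z hz
  -- Near `z`, `ψ z - 1 < ψ (s + t • d) ≤ M - t * δ` forces `t ≤ T`.
  let T : ℝ := (M - ψ z + 1) / δ
  let K : Set F := (fun p : ℝ × F => p.1 • p.2) '' (Icc 0 T ×ˢ D)
  have hKsub : K ⊆ generatedCone D := by
    rintro _ ⟨⟨t, d⟩, ⟨ht, hd⟩, rfl⟩
    rcases ht.1.eq_or_lt with h | h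
    · left; simp [show t = 0 from h.symm]
    · right; exact ⟨t, h, d, hd, rfl⟩
  -- `S` covers the zero of the cone, which `K` may miss, for instance when `D` is empty.
  have hz' : z ∈ closure (S + K ∪ S) := by
    have hopen : IsOpen {w | ψ z - 1 < ψ w} := isOpen_lt continuous_const ψ.continuous
    have h1 := hopen.inter_closure ⟨(by simp : z ∈ {w | ψ z - 1 < ψ w}), hz⟩
    refine closure_mono ?_ h1
    rintro _ ⟨hw, s, hs, g, hg, rfl⟩
    rcases hg with rfl | ⟨t, ht, d, hd, rfl⟩
    · right; simpa using hs
    · left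
      refine add_mem_add hs ⟨(t, d), ⟨⟨ht.le, ?_⟩, hd⟩, rfl⟩
      have h2 : ψ z - 1 < ψ (s + t • d) := hw
      rw [map_add, map_smul, smul_eq_mul] at h2
      have h3 := mul_le_mul_of_nonneg_left (hψD d hd) ht.le
      rw [le_div_iff₀ hδ]
      linarith [hψS s hs]
  rw [closure_union] at hz'
  rcases hz' with h | h
  · have hKc : IsCompact (toWeakSpace ℝ F '' K) := by
      have h1 := ((isCompact_Icc (a := (0 : ℝ)) (b := T)).prod hD).image
        (f := fun p : ℝ × WeakSpace ℝ F => p.1 • p.2) (by fun_prop)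
      convert h1 using 1
      ext w
      constructor
      · rintro ⟨_, ⟨⟨t, d⟩, ⟨ht, hd⟩, rfl⟩, rfl⟩
        exact ⟨(t, toWeakSpace ℝ F d), ⟨ht, d, hd, rfl⟩, by simp⟩
      · rintro ⟨⟨t, _⟩, ⟨ht, d, hd, rfl⟩, rfl⟩
        exact ⟨_, ⟨(t, d), ⟨ht, hd⟩, rfl⟩, by simp⟩
    -- By convexity, the norm closure of `S` is weakly closed.
    have hcl : IsClosed (toWeakSpace ℝ F '' closure S) := by
      rw [hS.toWeakSpace_closure ℝ]; exact isClosed_closure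
    have hsum : IsClosed (toWeakSpace ℝ F '' (closure S + K)) := by
      rw [image_add]
      exact hcl.add_right_of_isCompact hKc
    have hsum' : IsClosed (closure S + K) := by
      have := hsum.preimage (toWeakSpaceCLM ℝ F).continuous
      convert this using 1
      exact ((toWeakSpace ℝ F).injective.preimage_image _).symm
    exact add_subset_add_left hKsub
      (closure_minimal (add_subset_add_right subset_closure) hsum' h)
  · exact ⟨z, h, 0, Or.inl rfl, add_zero z⟩

/-! ### The main theorem -/

theorem mainTheorem9 {E : Type*} [NormedAddCommGroup E] [NormedSpace ℝ E] [CompleteSpace E]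
    (D B : Set (StrongDual ℝ E))
    (hD_ne : D.Nonempty) (hD_conv : Convex ℝ D) (hD_comp : IsWeakStarCompact D)
    (hD_zero : (0 : StrongDual ℝ E) ∉ D)
    (hB_ne : B.Nonempty)
    (h_attain : ∀ x ∈ directionSet D, ∃ b ∈ B, ((b x : ℝ) : EReal) = dualSup x B)
    (h_seq : ∀ L : Set E, Convex ℝ L → Bornology.IsBounded L →
      ∀ φ ∈ weakStarClosure (NormedSpace.inclusionInDoubleDual ℝ E '' L),
        ∃ y : ℕ → E, (∀ n, y n ∈ L) ∧
          ∀ z ∈ B ∪ D, Tendsto (fun n => z (y n)) atTop (𝓝 (φ z))) :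
    weakStarClosure (convexHull ℝ B) ⊆ closure (convexHull ℝ B + generatedCone D) ∧
      (IsWeaklyCompact D →
        weakStarClosure (convexHull ℝ B) ⊆ closure (convexHull ℝ B) + generatedCone D) := by
  have h_attain' : ∀ x ∈ directionSet D, ∃ b ∈ B, ∀ c ∈ B, c x ≤ b x := fun x hx =>
    let ⟨b, hb, hbx⟩ := h_attain x hx
    ⟨b, hb, forall_le_of_coe_eq_dualSup hbx⟩
  obtain ⟨x₀, δ, hδ, hx₀⟩ := hD_comp.exists_forall_le_neg hD_conv hD_zero
  obtain ⟨b₀, hb₀, hmax⟩ := h_attain' x₀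
    (mem_directionSet_of_forall_le hD_ne (neg_lt_zero.2 hδ) hx₀)
  set J := NormedSpace.inclusionInDoubleDual ℝ E
  have hfirst : weakStarClosure (convexHull ℝ B) ⊆
      closure (convexHull ℝ B + generatedCone D) := by
    intro f hf
    by_contra hcon
    obtain ⟨φ, s, hφs, hsf⟩ := geometric_hahn_banach_closed_point
      ((convex_convexHull ℝ B).add (convex_generatedCone hD_conv)).closure isClosed_closure hcon
    have hφB : ∀ b ∈ B, φ b < s := fun b hb => hφs b
      (subset_closure ⟨b, subset_convexHull ℝ B hb, 0, Or.inl rfl, add_zero b⟩)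
    have hφD : ∀ d ∈ D, φ d ≤ 0 := by
      intro d hd
      by_contra! hpos
      -- This multiple of `d` brings `φ` from `φ b₀` up to exactly `s`.
      have hc : 0 < (s - φ b₀) / φ d := div_pos (sub_pos.2 (hφB b₀ hb₀)) hpos
      have h1 := hφs _ (subset_closure (add_mem_add (subset_convexHull ℝ B hb₀)
        (Or.inr ⟨_, hc, d, hd, rfl⟩ : _ ∈ generatedCone D)))
      rw [map_add, map_smul, smul_eq_mul, div_mul_cancel₀ _ hpos.ne'] at h1
      linarith
    obtain ⟨ε, hε, hεs⟩ : ∃ ε : ℝ, 0 < ε ∧ ε * (b₀ x₀ - f x₀) < (φ f - s) / 2 := by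
      have hc : 0 < (φ f - s) / 2 := by linarith
      have hd : 0 < |b₀ x₀ - f x₀| + 1 := by positivity
      refine ⟨(φ f - s) / 2 / (|b₀ x₀ - f x₀| + 1), div_pos hc hd, ?_⟩
      rw [div_mul_eq_mul_div, div_lt_iff₀ hd]
      exact mul_lt_mul_of_pos_left (by linarith [le_abs_self (b₀ x₀ - f x₀)]) hc
    have hval : ∀ g : StrongDual ℝ E, (φ + ε • J x₀) g = φ g + ε * g x₀ := fun g => rfl
    -- Maximality of `b₀` shifts the bound on `B` by `ε * b₀ x₀`. By the choice of `ε`, over half of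
    -- the gap `φ f - s` survives, so `β` at a quarter is safe.
    refine bidual_not_separates hD_ne hD_conv hD_comp h_attain'
      (fun L hL hLb ψ hψ => ?_) hf (φ + ε • J x₀) (η := -(ε * δ / 2)) (α := s + ε * b₀ x₀)
      (β := s + ε * b₀ x₀ + (φ f - s) / 4) ?_ ?_ ?_ ?_ ?_
    · obtain ⟨y, hyL, hy⟩ := h_seq L hL hLb ψ hψ
      exact ⟨y, hyL, fun z hz => hy z (Or.inl hz)⟩
    · have : 0 < ε * δ := by positivity
      linarith
    · intro d hd
      have h1 := mul_le_mul_of_nonneg_left (hx₀ d hd) hε.le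
      have h2 : 0 < ε * δ := by positivity
      rw [hval]
      linarith [hφD d hd]
    · linarith
    · intro b hb
      have h1 := mul_le_mul_of_nonneg_left (hmax b hb) hε.le
      rw [hval]
      linarith [hφB b hb]
    · rw [hval]
      linarith
  refine ⟨hfirst, fun hDw => hfirst.trans ?_⟩
  refine closure_add_generatedCone_subset (convex_convexHull ℝ B) hDw (J x₀) hδ (M := b₀ x₀) ?_ hx₀
  exact fun g hg => convexHull_min hmax
    (convex_halfSpace_le (J x₀).toLinearMap.isLinear (b₀ x₀)) hg
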